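/- Write $\rightsquigarrow$ for strict implication. Fix a set $\mathrm{Prop}$ of propositional atoms and let $\mathcal{L}$ be the set of formulas $\varphi ::= p \mid \top \mid \bot \mid \varphi\wedge\varphi \mid \varphi\vee\varphi \mid \varphi\to\varphi \mid \varphi\rightsquigarrow \varphi$ with $p\in\mathrm{Prop}$. An \emph{$\mathsf{iA}$-logic} is a set $\Lambda\subseteq\mathcal{L}$ that contains all axioms of intuitionistic propositional calculus (for all formulas of $\mathcal{L}$) and all formulas $((\varphi\rightsquigarrow \psi)\wedge(\varphi\rightsquigarrow \chi))\to(\varphi\rightsquigarrow (\psi\wedge\chi))$, $((\varphi\rightsquigarrow \chi)\wedge(\psi\rightsquigarrow \chi))\to((\varphi\vee\psi)\rightsquigarrow \chi)$, $((\varphi\rightsquigarrow \psi)\wedge(\psi\rightsquigarrow \chi))\to(\varphi\rightsquigarrow \chi)$, and is closed under modus ponens, uniform substitution and arrow necessitation (if $\varphi\to\psi\in\Lambda$ then $\varphi\rightsquigarrow \psi\in\Lambda$). A \emph{general $\rightsquigarrow $-frame} is a tuple $(X,\preceq,\sqsubset,P)$ where $(X,\preceq)$ is a (possibly empty) poset,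 $\sqsubset$ is a binary relation on $X$ such that $x\preceq y\sqsubset z$ implies $x\sqsubset z$, and $P$ is a collection of upsets of $(X,\preceq)$ that contains $X$ and $\emptyset$ and is closed under $\cap$, $\cup$ and the operations $a\Rightarrow b=\{x \mid \forall y\,(x\preceq y\text{ and }y\in a\text{ imply }y\in b)\}$ and $a\rightarrowtail b=\{x \mid \forall y\,(x\sqsubset y\text{ and }y\in a\text{ imply }y\in b)\}$. It is \emph{descriptive} if moreover (i) for all $A\subseteq P$ and $B\subseteq\{X\setminus a\mid a\in P\}$, if every finite subfamily of $A\cup B$ has non-empty intersection (the empty family having intersection $X$), then $\bigcap(A\cup B)\neq\emptyset$; (ii) if $x\not\preceq y$ then there is $a\in P$ with $x\in a$ and $y\notin a$; (iii) if $x\not\sqsubset y$ then there are $a,b\in P$ with $x\in a\rightarrowtail b$, $y\in a$ and $y\notin b$. A formula $\varphi$ is \emph{valid} in a general $\rightsquigarrow $-frame if for every map $V:\mathrm{Prop}\to P$ the truth set of $\varphi$ is $X$, where truth sets are computed from $V$ by interpreting $\top,\bot,\wedge,\vee,\to,\rightsquigarrow $ as $X,\emptyset,\cap,\cup,\Rightarrow,\rightarrowtail$.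 \textbf{Theorem.} Every $\mathsf{iA}$-logic $\Lambda$ is characterised by a class of descriptive $\rightsquigarrow $-frames: there is a class $\mathcal{C}$ of descriptive $\rightsquigarrow $-frames such that for every formula $\varphi\in\mathcal{L}$, $\varphi\in\Lambda$ if and only if $\varphi$ is valid in every frame in $\mathcal{C}$. -/

import Mathlib

universe u v

namespace HeytingLewis

/-- Formulas of the language with strict implication over a set of propositional atoms.
`imp` is intuitionistic implication and `sto` is strict implication. -/
inductive Formula (Atom : Type u) : Type u
  | atom : Atom → Formula Atom
  | top : Formula Atom
  | bot : Formula Atom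
  | and : Formula Atom → Formula Atom → Formula Atom
  | or : Formula Atom → Formula Atom → Formula Atom
  | imp : Formula Atom → Formula Atom → Formula Atom
  | sto : Formula Atom → Formula Atom → Formula Atom

/-- Simultaneous substitution of formulas for atoms. -/
def Formula.subst {Atom : Type u} (s : Atom → Formula Atom) : Formula Atom → Formula Atom
  | .atom p => s p
  | .top => .top
  | .bot => .bot
  | .and φ ψ => .and (φ.subst s) (ψ.subst s)
  | .or φ ψ => .or (φ.subst s) (ψ.subst s)
  | .imp φ ψ => .imp (φ.subst s) (ψ.subst s)
  | .sto φ ψ => .sto (φ.subst s) (ψ.subst s)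

/-- A standard Hilbert axiomatisation of the intuitionistic propositional calculus
(its only rule is modus ponens). -/
inductive IPCAxiom {Atom : Type u} : Formula Atom → Prop
  | k (φ ψ : Formula Atom) : IPCAxiom (.imp φ (.imp ψ φ))
  | s (φ ψ χ : Formula Atom) :
      IPCAxiom (.imp (.imp φ (.imp ψ χ)) (.imp (.imp φ ψ) (.imp φ χ)))
  | andLeft (φ ψ : Formula Atom) : IPCAxiom (.imp (.and φ ψ) φ)
  | andRight (φ ψ : Formula Atom) : IPCAxiom (.imp (.and φ ψ) ψ)
  | andIntro (φ ψ : Formula Atom) : IPCAxiom (.imp φ (.imp ψ (.and φ ψ)))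
  | orLeft (φ ψ : Formula Atom) : IPCAxiom (.imp φ (.or φ ψ))
  | orRight (φ ψ : Formula Atom) : IPCAxiom (.imp ψ (.or φ ψ))
  | orElim (φ ψ χ : Formula Atom) :
      IPCAxiom (.imp (.imp φ χ) (.imp (.imp ψ χ) (.imp (.or φ ψ) χ)))
  | exFalso (φ : Formula Atom) : IPCAxiom (.imp .bot φ)
  | top : IPCAxiom .top

/-- The axioms of `iA` for strict implication. -/
inductive ArrowAxiom {Atom : Type u} : Formula Atom → Prop
  | ka (φ ψ χ : Formula Atom) :
      ArrowAxiom (.imp (.and (.sto φ ψ) (.sto φ χ)) (.sto φ (.and ψ χ)))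
  | di (φ ψ χ : Formula Atom) :
      ArrowAxiom (.imp (.and (.sto φ χ) (.sto ψ χ)) (.sto (.or φ ψ) χ))
  | tr (φ ψ χ : Formula Atom) :
      ArrowAxiom (.imp (.and (.sto φ ψ) (.sto ψ χ)) (.sto φ χ))

/-- An `iA`-logic. -/
structure IsLogic {Atom : Type u} (L : Set (Formula Atom)) : Prop where
  ipc : ∀ φ, IPCAxiom φ → φ ∈ L
  arrow : ∀ φ, ArrowAxiom φ → φ ∈ L
  modusPonens : ∀ φ ψ, Formula.imp φ ψ ∈ L → φ ∈ L → ψ ∈ L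
  arrowNecessitation : ∀ φ ψ, Formula.imp φ ψ ∈ L → Formula.sto φ ψ ∈ L
  substitution : ∀ (s : Atom → Formula Atom) (φ), φ ∈ L → φ.subst s ∈ L

/-- A strict implication frame: a poset with a compatible binary relation `r`. -/
structure StoFrame : Type (v + 1) where
  X : Type v
  [order : PartialOrder X]
  r : X → X → Prop
  r_of_le_of_r : ∀ x y z : X, x ≤ y → r y z → r x z

attribute [instance] StoFrame.order

namespace StoFrame

/-- Interpretation of intuitionistic implication. -/
def impSet (F : StoFrame.{v}) (a b : Set F.X) : Set F.X :=
  {x | ∀ y, x ≤ y → y ∈ a → y ∈ b}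

/-- Interpretation of strict implication. -/
def stoSet (F : StoFrame.{v}) (a b : Set F.X) : Set F.X :=
  {x | ∀ y, F.r x y → y ∈ a → y ∈ b}

/-- The truth set of a formula under a valuation of the atoms. -/
def truthSet (F : StoFrame.{v}) {Atom : Type u} (V : Atom → Set F.X) :
    Formula Atom → Set F.X
  | .atom p => V p
  | .top => Set.univ
  | .bot => ∅
  | .and φ ψ => F.truthSet V φ ∩ F.truthSet V ψ
  | .or φ ψ => F.truthSet V φ ∪ F.truthSet V ψ
  | .imp φ ψ => F.impSet (F.truthSet V φ) (F.truthSet V ψ)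
  | .sto φ ψ => F.stoSet (F.truthSet V φ) (F.truthSet V ψ)

end StoFrame

/-- A general strict implication frame: a strict implication frame with a collection `P`
of admissible upsets. -/
structure GeneralFrame : Type (v + 1) extends StoFrame.{v} where
  P : Set (Set X)
  isUpperSet : ∀ a ∈ P, IsUpperSet a
  univ_mem : Set.univ ∈ P
  empty_mem : ∅ ∈ P
  inter_mem : ∀ a ∈ P, ∀ b ∈ P, a ∩ b ∈ P
  union_mem : ∀ a ∈ P, ∀ b ∈ P, a ∪ b ∈ P
  imp_mem : ∀ a ∈ P, ∀ b ∈ P, toStoFrame.impSet a b ∈ P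
  sto_mem : ∀ a ∈ P, ∀ b ∈ P, toStoFrame.stoSet a b ∈ P

/-- The finite intersection property; the intersection of the empty family is the whole set. -/
def FiniteInter {X : Type v} (S : Set (Set X)) : Prop :=
  ∀ T ⊆ S, T.Finite → (⋂₀ T).Nonempty

namespace GeneralFrame

/-- Validity in a general frame: truth at all points under all admissible valuations. -/
def Validates (G : GeneralFrame.{v}) {Atom : Type u} (φ : Formula Atom) : Prop :=
  ∀ V : Atom → Set G.X, (∀ p, V p ∈ G.P) → G.truthSet V φ = Set.univ

/-- Descriptive general frames. -/
structure IsDescriptive (G : GeneralFrame.{v}) : Prop where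
  compact : ∀ A B : Set (Set G.X), A ⊆ G.P → B ⊆ {c | ∃ a ∈ G.P, c = aᶜ} →
    FiniteInter (A ∪ B) → (⋂₀ (A ∪ B)).Nonempty
  leRefined : ∀ x y : G.X, ¬ x ≤ y → ∃ a ∈ G.P, x ∈ a ∧ y ∉ a
  rRefined : ∀ x y : G.X, ¬ G.r x y →
    ∃ a ∈ G.P, ∃ b ∈ G.P, x ∈ G.stoSet a b ∧ y ∈ a ∧ y ∉ b

end GeneralFrame

/-- `L` is characterised by the class `C` of general frames: `L` is sound and complete
with respect to `C`. -/
def IsCharacterisedBy {Atom : Type u} (L : Set (Formula Atom))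
    (C : Set GeneralFrame.{v}) : Prop :=
  ∀ φ : Formula Atom, φ ∈ L ↔ ∀ G ∈ C, G.Validates φ

end HeytingLewis

/-!
An `iA`-logic `L` is complete for its Lindenbaum algebra, the formulas modulo provable equivalence,
which is a Heyting algebra with a strict implication. Every such algebra `A` has a dual frame: its
points are the prime filters of `A`, ordered by inclusion, with `x ⊏ y` when `a ⥽ b ∈ x` and
`a ∈ y` imply `b ∈ y`. The sets `{x | a ∈ x}` form a copy of `A` among the upsets of this frame, so
the Lindenbaum algebra and its dual frame validate the same formulas.

All prime filters needed come from one separation principle. If a preorder `r` on a distributive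
lattice still has `⊓` and `⊔` as meets and joins, and `r a b` fails, then some prime filter is
closed under `r`, contains `a` and omits `b`: separate the classes of `a` and `b` in the quotient
by `r`. Implication and strict implication at a point `x` give the preorders `a ⇨ b ∈ x` and
`a ⥽ b ∈ x`; for compactness, one takes inclusion relative to finitely many members of the family.
-/

namespace HeytingLewis

open Order

/-- Preorders for which `⊓` and `⊔` are binary meets and joins. On a lattice these are the
transitive relations that extend `≤` and are compatible with meets on the right and joins on the
left; on formulas, provable implication is the main example. -/
class IsLatticePreorder {α : Type*} [Min α] [Max α] (r : α → α → Prop) : Prop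
    extends IsPreorder α r where
  inf_le_left : ∀ a b, r (a ⊓ b) a
  inf_le_right : ∀ a b, r (a ⊓ b) b
  le_inf : ∀ {a b c}, r a b → r a c → r a (b ⊓ c)
  le_sup_left : ∀ a b, r a (a ⊔ b)
  le_sup_right : ∀ a b, r b (a ⊔ b)
  sup_le : ∀ {a b c}, r a c → r b c → r (a ⊔ b) c

namespace IsLatticePreorder

section Quotient

variable {α : Type*} [Min α] [Max α] {r : α → α → Prop} [IsLatticePreorder r] {a b c d : α}

theorem inf_le_inf (hab : r a b) (hcd : r c d) : r (a ⊓ c) (b ⊓ d) :=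
  le_inf (_root_.trans (inf_le_left a c) hab) (_root_.trans (inf_le_right a c) hcd)

theorem sup_le_sup (hab : r a b) (hcd : r c d) : r (a ⊔ c) (b ⊔ d) :=
  sup_le (_root_.trans hab (le_sup_left b d)) (_root_.trans hcd (le_sup_right b d))

instance : Lattice (Antisymmetrization α r) where
  le := Quotient.lift₂ r fun _ _ _ _ h₁ h₂ => propext
    ⟨fun h => _root_.trans h₁.2 (_root_.trans h h₂.1),
      fun h => _root_.trans h₁.1 (_root_.trans h h₂.2)⟩
  le_refl := by rintro ⟨a⟩; exact refl_of r a
  le_trans := by rintro ⟨a⟩ ⟨b⟩ ⟨c⟩; exact trans_of r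
  le_antisymm := by rintro ⟨a⟩ ⟨b⟩ hab hba; exact Quotient.sound ⟨hab, hba⟩
  inf := Quotient.map₂ (· ⊓ ·) fun _ _ h₁ _ _ h₂ =>
    ⟨inf_le_inf h₁.1 h₂.1, inf_le_inf h₁.2 h₂.2⟩
  sup := Quotient.map₂ (· ⊔ ·) fun _ _ h₁ _ _ h₂ =>
    ⟨sup_le_sup h₁.1 h₂.1, sup_le_sup h₁.2 h₂.2⟩
  inf_le_left := by rintro ⟨a⟩ ⟨b⟩; exact inf_le_left (r := r) a b
  inf_le_right := by rintro ⟨a⟩ ⟨b⟩; exact inf_le_right (r := r) a b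
  le_inf := by rintro ⟨a⟩ ⟨b⟩ ⟨c⟩; exact le_inf (r := r)
  le_sup_left := by rintro ⟨a⟩ ⟨b⟩; exact le_sup_left (r := r) a b
  le_sup_right := by rintro ⟨a⟩ ⟨b⟩; exact le_sup_right (r := r) a b
  sup_le := by rintro ⟨a⟩ ⟨b⟩ ⟨c⟩; exact sup_le (r := r)

end Quotient

theorem of_le {A : Type*} [Lattice A] {r : A → A → Prop} (of_le : ∀ {a b}, a ≤ b → r a b)
    (trans : ∀ {a b c}, r a b → r b c → r a c) (le_inf : ∀ {a b c}, r a b → r a c → r a (b ⊓ c))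
    (sup_le : ∀ {a b c}, r a c → r b c → r (a ⊔ b) c) : IsLatticePreorder r where
  refl _ := of_le le_rfl
  trans _ _ _ := trans
  inf_le_left _ _ := of_le _root_.inf_le_left
  inf_le_right _ _ := of_le _root_.inf_le_right
  le_inf := le_inf
  le_sup_left _ _ := of_le _root_.le_sup_left
  le_sup_right _ _ := of_le _root_.le_sup_right
  sup_le := sup_le

instance {A : Type*} [DistribLattice A] {r : A → A → Prop} [IsLatticePreorder r] :
    DistribLattice (Antisymmetrization A r) where
  le_sup_inf := by
    rintro ⟨a⟩ ⟨b⟩ ⟨c⟩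
    exact (congrArg (toAntisymmetrization r) (sup_inf_left a b c)).ge

/-- The projection of a lattice onto its quotient by a lattice preorder. -/
def toQuotient {A : Type*} [Lattice A] (r : A → A → Prop) [IsLatticePreorder r] :
    LatticeHom A (Antisymmetrization A r) where
  toFun := toAntisymmetrization r
  map_sup' _ _ := rfl
  map_inf' _ _ := rfl

end IsLatticePreorder

/-- The prime filters of an ordered set, the points of the dual frame; as a subtype of
`Order.PFilter` they are ordered by inclusion. -/
abbrev PrimeFilter (A : Type*) [Preorder A] : Type _ :=
  {F : PFilter A // F.IsPrime}

namespace PrimeFilter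

variable {A : Type*}

theorem sup_mem_iff [SemilatticeSup A] (x : PrimeFilter A) {a b : A} :
    a ⊔ b ∈ x.1 ↔ a ∈ x.1 ∨ b ∈ x.1 := by
  have compl_sup : a ⊔ b ∉ x.1 ↔ a ∉ x.1 ∧ b ∉ x.1 :=
    Ideal.sup_mem_iff (I := x.2.compl_ideal.toIdeal)
  rw [← not_iff_not, compl_sup, not_or]

theorem bot_notMem [Preorder A] [OrderBot A] (x : PrimeFilter A) : ⊥ ∉ x.1 :=
  x.2.compl_ideal.toIdeal.bot_mem

theorem exists_mem_iff_notMem_ideal {B : Type*} [Lattice A] [Lattice B] (f : LatticeHom A B)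
    {J : Ideal B} (hJ : J.IsPrime) {a b : A} (ha : f a ∉ J) (hb : f b ∈ J) :
    ∃ x : PrimeFilter A, ∀ c, c ∈ x.1 ↔ f c ∉ J := by
  have isPFilter : IsPFilter {c | f c ∉ J} := by
    refine .of_def ⟨a, ha⟩ (fun c hc d hd => ⟨c ⊓ d, ?_, inf_le_left, inf_le_right⟩)
      fun hcd hc hd => hc (J.lower (OrderHomClass.mono f hcd) hd)
    intro hcd
    rw [map_inf] at hcd
    exact (hJ.mem_or_mem hcd).elim hc hd
  have isIdeal : IsIdeal {c | f c ∈ J} := by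
    refine ⟨fun c d hdc => J.lower (OrderHomClass.mono f hdc), ⟨b, hb⟩,
      fun c hc d hd => ⟨c ⊔ d, ?_, le_sup_left, le_sup_right⟩⟩
    change f (c ⊔ d) ∈ J
    rw [map_sup]
    exact Ideal.sup_mem hc hd
  refine ⟨⟨isPFilter.toPFilter, ⟨?_⟩⟩, fun c => Iff.rfl⟩
  convert isIdeal
  ext c
  exact not_not

theorem exists_separating [DistribLattice A] (r : A → A → Prop) [IsLatticePreorder r] {a b : A}
    (hab : ¬ r a b) :
    ∃ x : PrimeFilter A, a ∈ x.1 ∧ b ∉ x.1 ∧ ∀ {c d}, r c d → c ∈ x.1 → d ∈ x.1 := by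
  let π := IsLatticePreorder.toQuotient r
  have disjoint : Disjoint (PFilter.principal (π a) : Set (Antisymmetrization A r))
      (Ideal.principal (π b)) :=
    Set.disjoint_left.2 fun c hac hcb =>
      hab (show π a ≤ π b from (PFilter.mem_principal.1 hac).trans (Ideal.mem_principal.1 hcb))
  obtain ⟨J, hJ, hbJ, haJ⟩ := DistribLattice.prime_ideal_of_disjoint_filter_ideal disjoint
  have ha : π a ∉ J := Set.disjoint_left.1 haJ (PFilter.mem_principal.2 le_rfl)
  have hb : π b ∈ J := Ideal.principal_le_iff.1 hbJ
  obtain ⟨x, hx⟩ := exists_mem_iff_notMem_ideal π hJ ha hb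
  refine ⟨x, (hx a).2 ha, fun hbx => (hx b).1 hbx hb, fun {c d} hcd hc => (hx d).2 fun hd => ?_⟩
  exact (hx c).1 hc (J.lower (show π c ≤ π d from hcd) hd)

end PrimeFilter

/-- The Stone map: the set of prime filters that contain `a`. -/
def primeFiltersAt {A : Type*} [Preorder A] (a : A) : Set (PrimeFilter A) :=
  {x | a ∈ x.1}

section StoneMap

variable {A : Type*}

theorem isUpperSet_primeFiltersAt [Preorder A] (a : A) : IsUpperSet (primeFiltersAt a) :=
  fun _ _ hxy ha => hxy ha

theorem primeFiltersAt_top [Preorder A] [OrderTop A] :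
    primeFiltersAt (⊤ : A) = Set.univ :=
  Set.eq_univ_of_forall fun _ => PFilter.top_mem

theorem primeFiltersAt_bot [Preorder A] [OrderBot A] : primeFiltersAt (⊥ : A) = ∅ :=
  Set.eq_empty_of_forall_notMem PrimeFilter.bot_notMem

theorem primeFiltersAt_inf [SemilatticeInf A] (a b : A) :
    primeFiltersAt (a ⊓ b) = primeFiltersAt a ∩ primeFiltersAt b :=
  Set.ext fun _ => PFilter.inf_mem_iff

theorem primeFiltersAt_sup [SemilatticeSup A] (a b : A) :
    primeFiltersAt (a ⊔ b) = primeFiltersAt a ∪ primeFiltersAt b :=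
  Set.ext fun x => x.sup_mem_iff

theorem primeFiltersAt_mono [Preorder A] {a b : A} (hab : a ≤ b) :
    primeFiltersAt a ⊆ primeFiltersAt b :=
  fun _ => PFilter.mem_of_le hab

theorem primeFiltersAt_eq_univ_iff [DistribLattice A] [OrderTop A] {a : A} :
    primeFiltersAt a = Set.univ ↔ a = ⊤ := by
  refine ⟨fun h => ?_, fun h => h ▸ primeFiltersAt_top⟩
  by_contra ha
  have : IsLatticePreorder ((· ≤ ·) : A → A → Prop) := .of_le id le_trans le_inf sup_le
  obtain ⟨x, -, hax, -⟩ := PrimeFilter.exists_separating (· ≤ ·) (mt top_le_iff.1 ha)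
  exact hax (Set.eq_univ_iff_forall.1 h x)

theorem isLatticePreorder_sInter_inter_subset [Lattice A] (S : Set (Set (PrimeFilter A))) :
    IsLatticePreorder fun a b : A =>
      ∃ T ⊆ S, T.Finite ∧ ⋂₀ T ∩ primeFiltersAt a ⊆ primeFiltersAt b := by
  refine .of_le (fun hab => ⟨∅, Set.empty_subset S, Set.finite_empty,
    Set.inter_subset_right.trans (primeFiltersAt_mono hab)⟩) ?_ ?_ ?_
  all_goals
    rintro a b c ⟨T, hT, hfin, h⟩ ⟨T', hT', hfin', h'⟩
    refine ⟨T ∪ T', Set.union_subset hT hT', hfin.union hfin', ?_⟩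
    rw [Set.sInter_union]
  · exact fun x hx => h' ⟨hx.1.2, h ⟨hx.1.1, hx.2⟩⟩
  · rw [primeFiltersAt_inf]
    exact fun x hx => ⟨h ⟨hx.1.1, hx.2⟩, h' ⟨hx.1.2, hx.2⟩⟩
  · rw [primeFiltersAt_sup]
    exact fun x hx => hx.2.elim (fun ha => h ⟨hx.1.1, ha⟩) fun hb => h' ⟨hx.1.2, hb⟩

theorem sInter_nonempty_of_finiteInter [DistribLattice A] [BoundedOrder A]
    {S : Set (Set (PrimeFilter A))}
    (hS : ∀ s ∈ S, ∃ a : A, s = primeFiltersAt a ∨ s = (primeFiltersAt a)ᶜ)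
    (hfip : FiniteInter S) : (⋂₀ S).Nonempty := by
  let r (a b : A) : Prop := ∃ T ⊆ S, T.Finite ∧ ⋂₀ T ∩ primeFiltersAt a ⊆ primeFiltersAt b
  have : IsLatticePreorder r := isLatticePreorder_sInter_inter_subset S
  have not_top_bot : ¬ r ⊤ ⊥ := by
    rintro ⟨T, hT, hfin, h⟩
    rw [primeFiltersAt_top, primeFiltersAt_bot, Set.inter_univ] at h
    exact (hfip T hT hfin).not_subset_empty h
  have of_mem {s : Set (PrimeFilter A)} (hs : s ∈ S) {a b : A}
      (h : s ∩ primeFiltersAt a ⊆ primeFiltersAt b) : r a b :=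
    ⟨{s}, Set.singleton_subset_iff.2 hs, Set.finite_singleton s, by rwa [Set.sInter_singleton]⟩
  obtain ⟨x, htop, hbot, hr⟩ := PrimeFilter.exists_separating r not_top_bot
  refine ⟨x, fun s hs => ?_⟩
  obtain ⟨a, rfl | rfl⟩ := hS s hs
  · exact hr (of_mem hs Set.inter_subset_left) htop
  · exact fun ha => hbot (hr (of_mem hs fun _ hy => (hy.1 hy.2).elim) ha)

end StoneMap

/-- Heyting algebras with a strict implication, the algebraic models of `iA`. The inequalities are
the axioms of `iA`, and `sto_eq_top_of_le` is arrow necessitation. -/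
class HeytingLewisAlgebra (A : Type*) extends HeytingAlgebra A where
  sto : A → A → A
  sto_inf_sto_le_sto_inf : ∀ a b c, sto a b ⊓ sto a c ≤ sto a (b ⊓ c)
  sto_inf_sto_le_sup_sto : ∀ a b c, sto a c ⊓ sto b c ≤ sto (a ⊔ b) c
  sto_inf_sto_le_sto : ∀ a b c, sto a b ⊓ sto b c ≤ sto a c
  sto_eq_top_of_le : ∀ {a b}, a ≤ b → sto a b = ⊤

open HeytingLewisAlgebra (sto)

/-- The interpretation of a formula in a Heyting algebra with strict implication. -/
def Formula.eval {Atom A : Type*} [HeytingLewisAlgebra A] (V : Atom → A) : Formula Atom → A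
  | .atom p => V p
  | .top => ⊤
  | .bot => ⊥
  | .and φ ψ => φ.eval V ⊓ ψ.eval V
  | .or φ ψ => φ.eval V ⊔ ψ.eval V
  | .imp φ ψ => φ.eval V ⇨ ψ.eval V
  | .sto φ ψ => HeytingLewisAlgebra.sto (φ.eval V) (ψ.eval V)

theorem PrimeFilter.isLatticePreorder_himp_mem {A : Type*} [HeytingAlgebra A]
    (x : PrimeFilter A) : IsLatticePreorder fun a b => a ⇨ b ∈ x.1 :=
  .of_le (fun hab => himp_eq_top_iff.2 hab ▸ PFilter.top_mem)
    (fun hab hbc => PFilter.mem_of_le (himp_triangle _ _ _) (PFilter.inf_mem hab hbc))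
    (fun hab hac => PFilter.mem_of_le (himp_inf_distrib _ _ _).ge (PFilter.inf_mem hab hac))
    (fun hac hbc => PFilter.mem_of_le (sup_himp_distrib _ _ _).ge (PFilter.inf_mem hac hbc))

theorem PrimeFilter.isLatticePreorder_sto_mem {A : Type*} [HeytingLewisAlgebra A]
    (x : PrimeFilter A) : IsLatticePreorder fun a b => sto a b ∈ x.1 :=
  .of_le (fun hab => HeytingLewisAlgebra.sto_eq_top_of_le hab ▸ PFilter.top_mem)
    (fun hab hbc => PFilter.mem_of_le (HeytingLewisAlgebra.sto_inf_sto_le_sto _ _ _)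
      (PFilter.inf_mem hab hbc))
    (fun hab hac => PFilter.mem_of_le (HeytingLewisAlgebra.sto_inf_sto_le_sto_inf _ _ _)
      (PFilter.inf_mem hab hac))
    (fun hac hbc => PFilter.mem_of_le (HeytingLewisAlgebra.sto_inf_sto_le_sup_sto _ _ _)
      (PFilter.inf_mem hac hbc))

section DualFrame

variable (A : Type v) [HeytingLewisAlgebra A]

/-- The frame of prime filters of a Heyting algebra with strict implication. -/
abbrev dualStoFrame : StoFrame.{v} where
  X := PrimeFilter A
  r x y := ∀ a b, sto a b ∈ x.1 → a ∈ y.1 → b ∈ y.1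
  r_of_le_of_r _ _ _ hxy hyz a b hab := hyz a b (Set.mem_of_subset_of_mem hxy hab)

variable {A}

theorem primeFiltersAt_himp (a b : A) :
    primeFiltersAt (a ⇨ b) = (dualStoFrame A).impSet (primeFiltersAt a) (primeFiltersAt b) := by
  ext x
  constructor
  · exact fun hx y hxy ha => PFilter.mem_of_le himp_inf_le (PFilter.inf_mem (hxy hx) ha)
  · intro hx
    by_contra hab
    have := x.isLatticePreorder_himp_mem
    obtain ⟨y, hay, hby, hy⟩ := PrimeFilter.exists_separating (fun c d => c ⇨ d ∈ x.1) hab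
    have hxy : x ≤ y := fun c hc => hy (PFilter.mem_of_le le_himp hc) hay
    exact hby (hx y hxy hay)

theorem primeFiltersAt_sto (a b : A) :
    primeFiltersAt (sto a b) =
      (dualStoFrame A).stoSet (primeFiltersAt a) (primeFiltersAt b) := by
  ext x
  constructor
  · exact fun hx y hxy ha => hxy a b hx ha
  · intro hx
    by_contra hab
    have := x.isLatticePreorder_sto_mem
    obtain ⟨y, hay, hby, hy⟩ := PrimeFilter.exists_separating (fun c d => sto c d ∈ x.1) hab
    exact hby (hx y (fun c d => hy) hay)

variable (A) in
/-- The dual of a Heyting algebra with strict implication: the frame of its prime filters, with the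
image of the Stone map as admissible sets. -/
def dualFrame : GeneralFrame.{v} where
  toStoFrame := dualStoFrame A
  P := Set.range primeFiltersAt
  isUpperSet := Set.forall_mem_range.2 isUpperSet_primeFiltersAt
  univ_mem := ⟨⊤, primeFiltersAt_top⟩
  empty_mem := ⟨⊥, primeFiltersAt_bot⟩
  inter_mem := by
    rintro _ ⟨a, rfl⟩ _ ⟨b, rfl⟩
    exact ⟨a ⊓ b, primeFiltersAt_inf a b⟩
  union_mem := by
    rintro _ ⟨a, rfl⟩ _ ⟨b, rfl⟩
    exact ⟨a ⊔ b, primeFiltersAt_sup a b⟩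
  imp_mem := by
    rintro _ ⟨a, rfl⟩ _ ⟨b, rfl⟩
    exact ⟨a ⇨ b, primeFiltersAt_himp a b⟩
  sto_mem := by
    rintro _ ⟨a, rfl⟩ _ ⟨b, rfl⟩
    exact ⟨sto a b, primeFiltersAt_sto a b⟩

variable (A) in
theorem isDescriptive_dualFrame : (dualFrame A).IsDescriptive where
  compact S T hS hT := by
    refine sInter_nonempty_of_finiteInter (A := A) ?_
    rintro s (hs | hs)
    · obtain ⟨a, rfl⟩ := hS hs
      exact ⟨a, .inl rfl⟩
    · obtain ⟨_, ⟨a, rfl⟩, rfl⟩ := hT hs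
      exact ⟨a, .inr rfl⟩
  leRefined x y hxy := by
    obtain ⟨a, hax, hay⟩ := Set.not_subset.1 hxy
    exact ⟨primeFiltersAt a, ⟨a, rfl⟩, hax, hay⟩
  rRefined x y hxy := by
    obtain ⟨a, b, hab, hay, hby⟩ : ∃ a b : A, sto a b ∈ x.1 ∧ a ∈ y.1 ∧ b ∉ y.1 := by
      by_contra! h
      exact hxy h
    exact ⟨primeFiltersAt a, ⟨a, rfl⟩, primeFiltersAt b, ⟨b, rfl⟩,
      fun z hxz => hxz a b hab, hay, hby⟩

theorem truthSet_primeFiltersAt {Atom : Type*} (V : Atom → A) (φ : Formula Atom) :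
    (dualStoFrame A).truthSet (fun p => primeFiltersAt (V p)) φ = primeFiltersAt (φ.eval V) := by
  induction φ with
  | atom p => rfl
  | top => exact primeFiltersAt_top.symm
  | bot => exact primeFiltersAt_bot.symm
  | and φ ψ hφ hψ => simp only [StoFrame.truthSet, Formula.eval, primeFiltersAt_inf, hφ, hψ]
  | or φ ψ hφ hψ => simp only [StoFrame.truthSet, Formula.eval, primeFiltersAt_sup, hφ, hψ]
  | imp φ ψ hφ hψ => simp only [StoFrame.truthSet, Formula.eval, primeFiltersAt_himp, hφ, hψ]
  | sto φ ψ hφ hψ => simp only [StoFrame.truthSet, Formula.eval, primeFiltersAt_sto, hφ, hψ]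

variable (A) in
theorem dualFrame_validates_iff {Atom : Type*} (φ : Formula Atom) :
    (dualFrame A).Validates φ ↔ ∀ V : Atom → A, φ.eval V = ⊤ := by
  constructor
  · intro h V
    rw [← primeFiltersAt_eq_univ_iff, ← truthSet_primeFiltersAt]
    exact h _ fun p => ⟨V p, rfl⟩
  · intro h U hU
    choose V hV using hU
    obtain rfl : (fun p => primeFiltersAt (V p)) = U := funext hV
    exact (truthSet_primeFiltersAt V φ).trans (primeFiltersAt_eq_univ_iff.2 (h V))

end DualFrame

variable {Atom : Type u}

instance : Min (Formula Atom) := ⟨.and⟩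

instance : Max (Formula Atom) := ⟨.or⟩

/-- Sets of formulas that contain the intuitionistic axioms and are closed under modus ponens. -/
structure IsTheory (T : Set (Formula Atom)) : Prop where
  ipc : ∀ {φ}, IPCAxiom φ → φ ∈ T
  mp : ∀ {φ ψ}, .imp φ ψ ∈ T → φ ∈ T → ψ ∈ T

/-- Provable implication in a set of formulas. -/
def Entails (T : Set (Formula Atom)) (φ ψ : Formula Atom) : Prop :=
  .imp φ ψ ∈ T

namespace IsTheory

variable {T : Set (Formula Atom)} {φ ψ χ : Formula Atom}

theorem entails_of_mem (hT : IsTheory T) (hψ : ψ ∈ T) : Entails T φ ψ :=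
  hT.mp (hT.ipc (.k ψ φ)) hψ

theorem entails_mp (hT : IsTheory T) (h : Entails T φ (.imp ψ χ)) (hψ : Entails T φ ψ) :
    Entails T φ χ :=
  hT.mp (hT.mp (hT.ipc (.s φ ψ χ)) h) hψ

theorem entails_trans (hT : IsTheory T) (hφψ : Entails T φ ψ) (hψχ : Entails T ψ χ) :
    Entails T φ χ :=
  hT.entails_mp (hT.entails_of_mem hψχ) hφψ

theorem isLatticePreorder_entails (hT : IsTheory T) : IsLatticePreorder (Entails T) where
  refl φ := hT.entails_mp (hT.ipc (.k φ (.imp φ φ))) (hT.ipc (.k φ φ))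
  trans _ _ _ := hT.entails_trans
  inf_le_left φ ψ := hT.ipc (.andLeft φ ψ)
  inf_le_right φ ψ := hT.ipc (.andRight φ ψ)
  le_inf hψ hχ := hT.entails_mp (hT.entails_trans hψ (hT.ipc (.andIntro _ _))) hχ
  le_sup_left φ ψ := hT.ipc (.orLeft φ ψ)
  le_sup_right φ ψ := hT.ipc (.orRight φ ψ)
  sup_le hφ hψ := hT.mp (hT.mp (hT.ipc (.orElim _ _ _)) hφ) hψ

theorem entails_imp_iff (hT : IsTheory T) :
    Entails T φ (.imp ψ χ) ↔ Entails T (φ ⊓ ψ) χ := by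
  constructor
  · exact fun h => hT.entails_mp (hT.entails_trans (hT.ipc (.andLeft φ ψ)) h)
      (hT.ipc (.andRight φ ψ))
  · exact fun h => hT.entails_trans (hT.ipc (.andIntro φ ψ))
      (hT.mp (hT.ipc (.s ψ _ χ)) (hT.entails_of_mem h))

theorem imp_entails_imp (hT : IsTheory T) {φ' ψ' : Formula Atom} (hφ : Entails T φ' φ)
    (hψ : Entails T ψ ψ') : Entails T (.imp φ ψ) (.imp φ' ψ') := by
  have hφ' : Entails T (.imp φ ψ ⊓ φ') φ := hT.entails_trans (hT.ipc (.andRight _ _)) hφ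
  exact hT.entails_imp_iff.2
    (hT.entails_trans (hT.entails_mp (hT.ipc (.andLeft _ _)) hφ') hψ)

/-- The Lindenbaum algebra of a theory: formulas modulo provable equivalence. -/
def Lindenbaum (hT : IsTheory T) : Type u :=
  @Antisymmetrization (Formula Atom) (Entails T) hT.isLatticePreorder_entails.toIsPreorder

/-- The class of a formula in the Lindenbaum algebra. -/
def toLindenbaum (hT : IsTheory T) (φ : Formula Atom) : hT.Lindenbaum :=
  have := hT.isLatticePreorder_entails
  toAntisymmetrization (Entails T) φ

instance (hT : IsTheory T) : HeytingAlgebra hT.Lindenbaum :=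
  have := hT.isLatticePreorder_entails
  { (inferInstance : Lattice (Antisymmetrization (Formula Atom) (Entails T))) with
    top := hT.toLindenbaum .top
    le_top := by rintro ⟨φ⟩; exact hT.entails_of_mem (hT.ipc .top)
    bot := hT.toLindenbaum .bot
    bot_le := by rintro ⟨φ⟩; exact hT.ipc (.exFalso φ)
    himp := Quotient.map₂ .imp fun _ _ hφ _ _ hψ =>
      ⟨hT.imp_entails_imp hφ.2 hψ.1, hT.imp_entails_imp hφ.1 hψ.2⟩
    le_himp_iff := by rintro ⟨φ⟩ ⟨ψ⟩ ⟨χ⟩; exact hT.entails_imp_iff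
    compl := _
    himp_bot := fun _ => rfl }

theorem toLindenbaum_eq_top_iff (hT : IsTheory T) : hT.toLindenbaum φ = ⊤ ↔ φ ∈ T := by
  rw [← top_le_iff]
  exact ⟨fun h => hT.mp (φ := .top) h (hT.ipc .top), hT.entails_of_mem⟩

end IsTheory

namespace IsLogic

variable {L : Set (Formula Atom)}

theorem isTheory (hL : IsLogic L) : IsTheory L :=
  ⟨hL.ipc _, hL.modusPonens _ _⟩

theorem sto_entails_sto (hL : IsLogic L) {φ φ' ψ ψ' : Formula Atom} (hφ : Entails L φ' φ)
    (hψ : Entails L ψ ψ') : Entails L (.sto φ ψ) (.sto φ' ψ') := by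
  have hT := hL.isTheory
  have le_inf {χ θ θ' : Formula Atom} :
      Entails L χ θ → Entails L χ θ' → Entails L χ (θ ⊓ θ') :=
    hT.isLatticePreorder_entails.le_inf
  have refl : Entails L (.sto φ ψ) (.sto φ ψ) := hT.isLatticePreorder_entails.refl _
  have hleft : Entails L (.sto φ ψ) (.sto φ' ψ) := hT.entails_trans
    (le_inf (hT.entails_of_mem (hL.arrowNecessitation _ _ hφ)) refl) (hL.arrow _ (.tr φ' φ ψ))
  exact hT.entails_trans
    (le_inf hleft (hT.entails_of_mem (hL.arrowNecessitation _ _ hψ))) (hL.arrow _ (.tr φ' ψ ψ'))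

/-- The Lindenbaum algebra of an `iA`-logic. It is not an abbreviation, because unification could
not recover `hL` from the proof `hL.isTheory` when searching for its strict implication. -/
def Lindenbaum (hL : IsLogic L) : Type u :=
  hL.isTheory.Lindenbaum

instance (hL : IsLogic L) : HeytingLewisAlgebra hL.Lindenbaum where
  toHeytingAlgebra := inferInstanceAs (HeytingAlgebra hL.isTheory.Lindenbaum)
  sto := Quotient.map₂ .sto fun _ _ hφ _ _ hψ =>
    ⟨hL.sto_entails_sto hφ.2 hψ.1, hL.sto_entails_sto hφ.1 hψ.2⟩
  sto_inf_sto_le_sto_inf := by rintro ⟨φ⟩ ⟨ψ⟩ ⟨χ⟩; exact hL.arrow _ (.ka φ ψ χ)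
  sto_inf_sto_le_sup_sto := by rintro ⟨φ⟩ ⟨ψ⟩ ⟨χ⟩; exact hL.arrow _ (.di φ ψ χ)
  sto_inf_sto_le_sto := by rintro ⟨φ⟩ ⟨ψ⟩ ⟨χ⟩; exact hL.arrow _ (.tr φ ψ χ)
  sto_eq_top_of_le := by
    rintro ⟨φ⟩ ⟨ψ⟩ h
    exact hL.isTheory.toLindenbaum_eq_top_iff.2 (hL.arrowNecessitation φ ψ h)

theorem eval_toLindenbaum (hL : IsLogic L) (s : Atom → Formula Atom) (φ : Formula Atom) :
    φ.eval (A := hL.Lindenbaum) (fun p => hL.isTheory.toLindenbaum (s p)) =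
      hL.isTheory.toLindenbaum (φ.subst s) := by
  induction φ with
  | atom p => rfl
  | top => rfl
  | bot => rfl
  | and φ ψ hφ hψ => exact congrArg₂ (· ⊓ ·) hφ hψ
  | or φ ψ hφ hψ => exact congrArg₂ (· ⊔ ·) hφ hψ
  | imp φ ψ hφ hψ => exact congrArg₂ (· ⇨ ·) hφ hψ
  | sto φ ψ hφ hψ => exact congrArg₂ sto hφ hψ

end IsLogic

theorem Formula.subst_atom (φ : Formula Atom) : φ.subst .atom = φ := by
  induction φ <;> simp_all only [Formula.subst]

theorem IsLogic.mem_iff_forall_eval_eq_top {L : Set (Formula Atom)} (hL : IsLogic L)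
    {φ : Formula Atom} : φ ∈ L ↔ ∀ V : Atom → hL.Lindenbaum, φ.eval V = ⊤ := by
  constructor
  · intro hφ V
    obtain ⟨s, rfl⟩ : ∃ s : Atom → Formula Atom, (fun p => hL.isTheory.toLindenbaum (s p)) = V :=
      ⟨fun p => (V p).out, funext fun p => Quotient.out_eq (V p)⟩
    exact (hL.eval_toLindenbaum s φ).trans
      (hL.isTheory.toLindenbaum_eq_top_iff.2 (hL.substitution s φ hφ))
  · intro h
    rw [← φ.subst_atom]
    exact hL.isTheory.toLindenbaum_eq_top_iff.1 ((hL.eval_toLindenbaum .atom φ).symm.trans (h _))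

end HeytingLewis

theorem mainTheorem8 {Atom : Type u} (L : Set (HeytingLewis.Formula Atom))
    (hL : HeytingLewis.IsLogic L) :
    ∃ C : Set HeytingLewis.GeneralFrame.{u},
      (∀ G ∈ C, G.IsDescriptive) ∧ HeytingLewis.IsCharacterisedBy L C := by
  refine ⟨{HeytingLewis.dualFrame hL.Lindenbaum}, ?_, fun φ => ?_⟩
  · rintro G rfl
    exact HeytingLewis.isDescriptive_dualFrame hL.Lindenbaum
  · rw [hL.mem_iff_forall_eval_eq_top, ← HeytingLewis.dualFrame_validates_iff]
    simp only [Set.mem_singleton_iff, forall_eq]
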